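/- **CDAGs.** For $n\ge 2$ let $\mathcal G(n)$ be the family of finite directed graphs $G$ built as follows. For every pair $1\le i\le j\le n$ take a binary tree (every vertex has at most two children) with all edges directed towards its root $v_{i,j}$; the trees of distinct pairs are vertex-disjoint. For $i=j$ the tree is the single vertex $v_{i,i}$; for $i<j$ it has exactly $j-i$ leaves $\ell^{i,j}_0,\dots,\ell^{i,j}_{j-i-1}$, and its shape, as well as the placement of the $\ell^{i,j}_k$ in it, is arbitrary. Finally, for every $i<j$ and $0\le k<j-i$, add edges from $v_{i,i+k}$ and from $v_{i+k+1,j}$ to $\ell^{i,j}_k$. The inputs of $G$ (vertices without predecessors) are $v_{1,1},\dots,v_{n,n}$, and its only output (vertex without successors) is $v_{1,n}$. **Cost model.** A schedule evaluates $G$ on a machine with a cache that holds at most $M$ words, initially empty, and an unbounded slow memory that initially contains the input values and nothing else. At each step it may: compute a non-input vertex all of whose predecessors are in the cache, placing its value in the cache (a vertex may be computed any number of times); discard a value from the cache; or perform one I/O operation, which copies at most $B$ words between the cache and consecutive locations of the slow memory, in either direction. At the end the output value must be in the slow memory. The I/O complexity $IO_G(n,M,B)$ is the minimum number of I/O operations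 over all schedules ($+\infty$ if there is none). **Theorem.** For all integers $n\ge 2$, $M\ge 1$, $B\ge 1$ and every $G\in\mathcal G(n)$, $$IO_G(n,M,B)\;\ge\;\max\left\{\frac{(n-6M-1)^3}{18\sqrt M}-2M,\;n\right\}\cdot\frac1B .$$ Consequently there are absolute constants $c,K>0$ such that, for all such $n,M,B,G$ with $M\le c\,n$, $$IO_G(n,M,B)\;\ge\;K\,\frac{n^3}{\sqrt M\,B}.$$ -/

import Mathlib

universe u

namespace DPIO

/-- An input vertex of a computational DAG: a vertex without predecessors. -/
def IsInput {V : Type u} (G : Digraph V) (v : V) : Prop := ∀ u, ¬ G.Adj u v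

/-- An output vertex of a computational DAG: a vertex without successors. -/
def IsOutput {V : Type u} (G : Digraph V) (v : V) : Prop := ∀ w, ¬ G.Adj v w

/-! ### The family of CDAGs of the prototype dynamic programming algorithm -/

/-- The way in which a digraph `G` is built from the subproblems `S(i,j)`, `1 ≤ i ≤ j ≤ n`.
Every vertex lies in the tree of exactly one subproblem, `S(lo v, hi v)`; this makes
the trees of distinct subproblems vertex-disjoint. `root i j` is the `R`-vertex of `S(i,j)`, and
`leaf i j k`, for `k < j - i`, is the `k`-th `L`-vertex of `S(i,j)`. (The values of `root` and `leaf`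
at other arguments carry no meaning.) The shape of the trees, and the way in which the `L`-vertices
are distributed over their leaves, is arbitrary. -/
structure Decomposition {V : Type u} (n : ℕ) (G : Digraph V) where
  lo : V → ℕ
  hi : V → ℕ
  root : ℕ → ℕ → V
  leaf : ℕ → ℕ → ℕ → V
  range : ∀ v, 1 ≤ lo v ∧ lo v ≤ hi v ∧ hi v ≤ n
  root_mem : ∀ i j, 1 ≤ i → i ≤ j → j ≤ n → lo (root i j) = i ∧ hi (root i j) = j
  leaf_mem : ∀ i j k, 1 ≤ i → j ≤ n → k < j - i → lo (leaf i j k) = i ∧ hi (leaf i j k) = j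
  leaf_inj : ∀ i j k l, 1 ≤ i → j ≤ n → k < j - i → l < j - i → leaf i j k = leaf i j l → k = l
  /-- The subproblem `S(i,i)` contributes a single vertex. -/
  singleton : ∀ v, lo v = hi v → v = root (lo v) (hi v)
  /-- The root of a tree has no successor in its tree. -/
  root_top : ∀ i j w, 1 ≤ i → i ≤ j → j ≤ n → G.Adj (root i j) w → ¬ (lo w = i ∧ hi w = j)
  /-- Every other vertex of a tree has exactly one successor in its tree. -/
  parent : ∀ v, v ≠ root (lo v) (hi v) → ∃! w, G.Adj v w ∧ lo w = lo v ∧ hi w = hi v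
  /-- The edges of a tree lead to its root. -/
  reach : ∀ v, Relation.ReflTransGen (fun x y => G.Adj x y ∧ lo y = lo x ∧ hi y = hi x)
    v (root (lo v) (hi v))
  /-- The trees are binary: a vertex has at most two predecessors in its tree. -/
  binary : ∀ v, {u | G.Adj u v ∧ lo u = lo v ∧ hi u = hi v}.encard ≤ 2
  /-- The leaves of the tree of `S(i,j)`, `i < j`, are exactly its `j - i` `L`-vertices. -/
  leaves : ∀ v, lo v < hi v →
    ((∀ u, G.Adj u v → ¬ (lo u = lo v ∧ hi u = hi v)) ↔
      ∃ k, k < hi v - lo v ∧ v = leaf (lo v) (hi v) k)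
  /-- The edges between distinct trees: the `k`-th `L`-vertex of `S(i,j)` has as predecessors the
  `R`-vertices of `S(i,i+k)` and `S(i+k+1,j)`. -/
  cross : ∀ u v, ¬ (lo u = lo v ∧ hi u = hi v) →
    (G.Adj u v ↔ ∃ i j k, 1 ≤ i ∧ j ≤ n ∧ k < j - i ∧ v = leaf i j k ∧
      (u = root i (i + k) ∨ u = root (i + k + 1) j))

/-- The family `𝒢(n)`, as a set of digraphs on the vertex type `V`. -/
def dpFamily (V : Type u) (n : ℕ) : Set (Digraph V) := {G | Nonempty (Decomposition n G)}

/-! ### The two-level memory with block transfers -/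

/-- The state of the memory: the set of values in the cache, and the content of each location of
the unbounded slow memory. -/
structure Config (V : Type u) where
  cache : Finset V
  mem : ℕ → Option V

/-- The elementary steps of a schedule. `read a l` copies the words in the `l` consecutive
slow memory locations `a, …, a + l - 1` to the cache; `write a vs` copies the list of values `vs`
from the cache to the consecutive slow memory locations `a, a + 1, …`. -/
inductive Move (V : Type u)
  | compute (v : V)
  | evict (v : V)
  | read (a l : ℕ)
  | write (a : ℕ) (vs : List V)

/-- The effect of a step. -/
def Config.step {V : Type u} [DecidableEq V] (s : Config V) : Move V → Config V
  | .compute v => ⟨insert v s.cache, s.mem⟩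
  | .evict v => ⟨s.cache.erase v, s.mem⟩
  | .read a l => ⟨s.cache ∪ (Finset.range l).biUnion (fun t => (s.mem (a + t)).toFinset), s.mem⟩
  | .write a vs => ⟨s.cache, fun x => if a ≤ x then (vs[x - a]?).or (s.mem x) else s.mem x⟩

/-- The rules: only non-input vertices are computed, when all their operands are in the cache;
a value may be computed any number of times; an I/O operation moves at most `B` words; only values
in the cache are written; the cache never holds more than `M` values. -/
def Config.Legal {V : Type u} [DecidableEq V] (G : Digraph V) (M B : ℕ) (s : Config V)
    (m : Move V) : Prop :=
  (s.step m).cache.card ≤ M ∧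
  match m with
  | .compute v => ¬ IsInput G v ∧ ∀ u, G.Adj u v → u ∈ s.cache
  | .evict _ => True
  | .read _ l => l ≤ B
  | .write _ vs => vs.length ≤ B ∧ ∀ v ∈ vs, v ∈ s.cache

/-- All steps of the schedule are legal when it is started in state `s`. -/
def Config.AllLegal {V : Type u} [DecidableEq V] (G : Digraph V) (M B : ℕ) :
    Config V → List (Move V) → Prop
  | _, [] => True
  | s, m :: ms => s.Legal G M B m ∧ (s.step m).AllLegal G M B ms

/-- The state after a schedule has been executed from state `s`. -/
def Config.run {V : Type u} [DecidableEq V] (s : Config V) (ms : List (Move V)) : Config V :=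
  ms.foldl Config.step s

/-- A schedule that evaluates `G` with a cache of `M` words and blocks of `B` words.
At the start the cache is empty and the slow memory holds the input values
(in any arrangement) and nothing else; at the end every output value is in the slow memory. -/
structure IsSchedule {V : Type u} [DecidableEq V] (G : Digraph V) (M B : ℕ)
    (mem₀ : ℕ → Option V) (ms : List (Move V)) : Prop where
  inputs_only : ∀ a v, mem₀ a = some v → IsInput G v
  inputs_stored : ∀ v, IsInput G v → ∃ a, mem₀ a = some v
  legal : (Config.mk ∅ mem₀).AllLegal G M B ms
  outputs_stored : ∀ v, IsOutput G v → ∃ a, ((Config.mk ∅ mem₀).run ms).mem a = some v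

/-- Whether a step is an I/O operation. -/
def Move.isIO {V : Type u} : Move V → Bool
  | .compute _ => false
  | .evict _ => false
  | .read _ _ => true
  | .write _ _ => true

/-- The number of I/O operations of a schedule. -/
def ioCount {V : Type u} (ms : List (Move V)) : ℕ := ms.countP Move.isIO

/-- The I/O complexity of `G`: the minimum number of I/O operations over all schedules, recomputation
being allowed (it is `⊤` if the cache is too small for any schedule to exist). -/
noncomputable def ioComplexity {V : Type u} [DecidableEq V] (G : Digraph V) (M B : ℕ) : ℕ∞ :=
  ⨅ (mem₀ : ℕ → Option V) (ms : List (Move V)) (_ : IsSchedule G M B mem₀ ms), (ioCount ms : ℕ∞)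

end DPIO

namespace DPIO

/-! A block transfer is at most `B` single-word transfers, so it suffices to bound the word
transfers of a red-blue pebbling. Recomputation is neutralised by liveness: only computations whose
result contributes to the final output count (`Trace.Useful`), and every leaf has at least one of
these.

Cut the pebbling into segments with at most `2 * M` transfers. At most `3 * M` subproblems are then
supplied to a segment from outside. If a leaf with split `(i, m, j)` is usefully computed there,
both operands are in the cache. A long operand must belong to a supplied subproblem: rebuilding it
from nothing would draw on more than `3 * M` others (`Accessed.mem_supply`). The useful result must
in turn leave a trace: some value of the tree of `S(i,j)` survives the segment, or the root is
computed in it, and then `S(i,j)` is itself supplied (`Useful.survives_or_root`). So the projections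
of the split triples to `(i, m)`, `(m, j)`, `(i, j)` have at most `3 * M`, `3 * M`, `4 * M`
elements, and Loomis-Whitney allows at most `6 * M * √M` triples per segment. Comparing with the
roughly `n ^ 3 / 6` triples with long operands gives the cubic term; the linear term holds because
every input must be loaded. -/

/-! ### Word-by-word pebbling -/

/-- The moves of the red-blue pebble game, which transfer one word at a time. -/
inductive PebbleMove (V : Type u)
  | compute (v : V)
  | evict (v : V)
  | load (v : V)
  | store (v : V)

/-- Whether a pebble move is an I/O operation. -/
def PebbleMove.isIO {V : Type u} : PebbleMove V → Bool
  | .compute _ => false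
  | .evict _ => false
  | .load _ => true
  | .store _ => true

/-- The effect of a pebble move on the cache and on the set of values that have been stored. -/
def PebbleMove.act {V : Type u} [DecidableEq V] :
    PebbleMove V → Finset V × Set V → Finset V × Set V
  | .compute v, s => (insert v s.1, s.2)
  | .evict v, s => (s.1.erase v, s.2)
  | .load v, s => (insert v s.1, s.2)
  | .store v, s => (s.1, insert v s.2)

/-- The rules of the red-blue pebble game with `M` red pebbles. -/
def PebbleMove.Legal {V : Type u} [DecidableEq V] (G : Digraph V) (M : ℕ)
    (m : PebbleMove V) (s : Finset V × Set V) : Prop :=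
  (m.act s).1.card ≤ M ∧
  match m with
  | .compute v => ¬ IsInput G v ∧ ∀ u, G.Adj u v → u ∈ s.1
  | .evict _ => True
  | .load v => v ∈ s.2
  | .store v => v ∈ s.1

/-- A sequence of legal pebble moves leading from one state to another. -/
inductive PebblePath {V : Type u} [DecidableEq V] (G : Digraph V) (M : ℕ) :
    Finset V × Set V → List (PebbleMove V) → Finset V × Set V → Prop
  | nil (s) : PebblePath G M s [] s
  | cons {s m ms s'} : m.Legal G M s → PebblePath G M (m.act s) ms s' →
      PebblePath G M s (m :: ms) s'

theorem countP_map_load {V : Type u} (vs : List V) :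
    (vs.map PebbleMove.load).countP PebbleMove.isIO = vs.length := by
  induction vs with
  | nil => rfl
  | cons v vs ih => simp [List.countP_cons, ih, PebbleMove.isIO]

theorem countP_map_store {V : Type u} (vs : List V) :
    (vs.map PebbleMove.store).countP PebbleMove.isIO = vs.length := by
  induction vs with
  | nil => rfl
  | cons v vs ih => simp [List.countP_cons, ih, PebbleMove.isIO]

section Pebbling

variable {V : Type u} [DecidableEq V] {G : Digraph V} {M B : ℕ}

theorem PebblePath.append {s s' s'' : Finset V × Set V} {ms ms' : List (PebbleMove V)}
    (h : PebblePath G M s ms s') (h' : PebblePath G M s' ms' s'') :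
    PebblePath G M s (ms ++ ms') s'' := by
  induction h with
  | nil => exact h'
  | cons hl _ ih => exact .cons hl (ih h')

/-- All intermediate caches lie in the last one, so its capacity bound suffices. -/
theorem PebblePath.loads (vs : List V) (C : Finset V) (S : Set V) (hS : ∀ v ∈ vs, v ∈ S)
    (hM : (C ∪ vs.toFinset).card ≤ M) :
    PebblePath G M (C, S) (vs.map .load) (C ∪ vs.toFinset, S) := by
  induction vs generalizing C with
  | nil => simpa using PebblePath.nil _
  | cons v vs ih =>
    have e : C ∪ (v :: vs).toFinset = insert v C ∪ vs.toFinset := by ext; simp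
    rw [e] at hM ⊢
    refine .cons ⟨(Finset.card_le_card Finset.subset_union_left).trans hM, hS v (by simp)⟩ ?_
    exact ih _ (fun w hw => hS w (by simp [hw])) hM

theorem PebblePath.stores (vs : List V) (C : Finset V) (S : Set V) (hC : ∀ v ∈ vs, v ∈ C)
    (hM : C.card ≤ M) :
    PebblePath G M (C, S) (vs.map .store) (C, S ∪ {v | v ∈ vs}) := by
  induction vs generalizing S with
  | nil => simpa using PebblePath.nil _
  | cons v vs ih =>
    have e : S ∪ {w | w ∈ v :: vs} = insert v S ∪ {w | w ∈ vs} := by ext; simp; tauto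
    rw [e]
    exact .cons ⟨hM, hC v (by simp)⟩ (ih _ (fun w hw => hC w (by simp [hw])))

/-- A single block move is simulated by pebble moves. -/
theorem exists_pebblePath_step (s : Config V) (m : Move V) (hm : s.Legal G M B m) (S : Set V)
    (hS : ∀ a v, s.mem a = some v → v ∈ S) :
    ∃ (ps : List (PebbleMove V)) (S' : Set V),
      PebblePath G M (s.cache, S) ps ((s.step m).cache, S') ∧
      (∀ a v, (s.step m).mem a = some v → v ∈ S') ∧
      ps.countP PebbleMove.isIO ≤ if Move.isIO m then B else 0 := by
  obtain ⟨hc, hm⟩ := hm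
  cases m with
  | compute v => exact ⟨[.compute v], S, .cons ⟨hc, hm⟩ (.nil _), hS, by simp [PebbleMove.isIO]⟩
  | evict v => exact ⟨[.evict v], S, .cons ⟨hc, trivial⟩ (.nil _), hS, by simp [PebbleMove.isIO]⟩
  | read a l =>
    -- Empty locations give no load, so there are at most `l` of them.
    set vs := (List.range l).filterMap (fun t => s.mem (a + t)) with hvs
    have e : (s.step (.read a l)).cache = s.cache ∪ vs.toFinset := by
      ext w
      simp [Config.step, hvs]
    refine ⟨vs.map .load, S, ?_, hS, ?_⟩
    · rw [e] at hc ⊢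
      refine PebblePath.loads vs _ _ (fun v hv => ?_) hc
      obtain ⟨t, -, ht⟩ := List.mem_filterMap.1 hv
      exact hS _ _ ht
    · rw [countP_map_load]
      have : vs.length ≤ (List.range l).length := List.length_filterMap_le _ _
      simp only [List.length_range] at this
      simpa [Move.isIO] using this.trans hm
  | write a vs =>
    -- Overwritten values remain in the pebble game's slow memory, which only grows; hence the
    -- invariant is an inclusion.
    refine ⟨vs.map .store, S ∪ {v | v ∈ vs}, PebblePath.stores vs _ _ hm.2 hc, ?_, ?_⟩
    · intro x v hv
      simp only [Config.step] at hv
      split_ifs at hv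
      · rcases h : vs[x - a]? with _ | w
        · rw [h] at hv
          exact Or.inl (hS x v (by simpa using hv))
        · rw [h] at hv
          have : w = v := by simpa using hv
          exact Or.inr (this ▸ List.mem_of_getElem? h)
      · exact Or.inl (hS _ _ hv)
    · rw [countP_map_store]
      simpa [Move.isIO] using hm.1

/-- A schedule with blocks of `B` words is simulated by a pebbling that has at most `B` times
as many I/O operations. -/
theorem exists_pebblePath (ms : List (Move V)) (s : Config V) (hs : s.AllLegal G M B ms)
    (S : Set V) (hS : ∀ a v, s.mem a = some v → v ∈ S) :
    ∃ (ps : List (PebbleMove V)) (S' : Set V),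
      PebblePath G M (s.cache, S) ps ((s.run ms).cache, S') ∧
      (∀ a v, (s.run ms).mem a = some v → v ∈ S') ∧
      ps.countP PebbleMove.isIO ≤ B * ioCount ms := by
  induction ms generalizing s S with
  | nil => exact ⟨[], S, .nil _, hS, by simp⟩
  | cons m ms ih =>
    obtain ⟨ps, S', hp, hS', hcount⟩ := exists_pebblePath_step s m hs.1 S hS
    obtain ⟨qs, S'', hq, hS'', hcount'⟩ := ih (s.step m) hs.2 S' hS'
    refine ⟨ps ++ qs, S'', hp.append hq, hS'', ?_⟩
    have : ioCount (m :: ms) = ioCount ms + if Move.isIO m then 1 else 0 := by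
      simp [ioCount, List.countP_cons]
    rw [List.countP_append, this, mul_add]
    have : (if Move.isIO m then B else 0) = B * if Move.isIO m then 1 else 0 := by split_ifs <;> simp
    omega

end Pebbling

/-! ### Pebblings as functions of time -/

/-- A pebbling of `G`, recorded as a function of time; at time `T` it has ended. -/
structure Trace {V : Type u} (G : Digraph V) (M T : ℕ) where
  cache : ℕ → Finset V
  slow : ℕ → Set V
  op : ℕ → Option (PebbleMove V)
  cache_zero : cache 0 = ∅
  slow_zero : ∀ v ∈ slow 0, IsInput G v
  card_cache_le : ∀ t ≤ T, (cache t).card ≤ M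
  cache_succ : ∀ t < T, ∀ v ∈ cache (t + 1),
    v ∈ cache t ∨ op t = some (.compute v) ∨ op t = some (.load v)
  slow_succ : ∀ t < T, ∀ v ∈ slow (t + 1), v ∈ slow t ∨ op t = some (.store v)
  compute_legal : ∀ t < T, ∀ v, op t = some (.compute v) →
    ¬ IsInput G v ∧ ∀ u, G.Adj u v → u ∈ cache t
  load_legal : ∀ t < T, ∀ v, op t = some (.load v) → v ∈ slow t
  store_legal : ∀ t < T, ∀ v, op t = some (.store v) → v ∈ cache t

/-- The number of I/O operations of a trace in the time interval `[s, e)`. -/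
def Trace.cost {V : Type u} {G : Digraph V} {M T : ℕ} (τ : Trace G M T) (s e : ℕ) : ℕ :=
  ((Finset.Ico s e).filter (fun t => (τ.op t).any PebbleMove.isIO)).card

section Trace

variable {V : Type u} {G : Digraph V} {M : ℕ}

theorem PebblePath.exists_states [DecidableEq V] {s s' : Finset V × Set V}
    {ms : List (PebbleMove V)} (h : PebblePath G M s ms s') :
    ∃ c : ℕ → Finset V × Set V, c 0 = s ∧ c ms.length = s' ∧
      ∀ t m, ms[t]? = some m → m.Legal G M (c t) ∧ c (t + 1) = m.act (c t) := by
  induction h with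
  | nil s => exact ⟨fun _ => s, rfl, rfl, by simp⟩
  | @cons s m ms s' hl _ ih =>
    obtain ⟨c, h0, hT, hc⟩ := ih
    refine ⟨fun t => Nat.casesOn t s c, rfl, hT, ?_⟩
    rintro (_ | t) m' h
    · obtain rfl : m = m' := by simpa using h
      exact ⟨hl, h0⟩
    · exact hc t m' (by simpa using h)

theorem card_filter_getElem?_any {α : Type*} (p : α → Bool) (l : List α) :
    ((Finset.range l.length).filter (fun t => (l[t]?).any p)).card = l.countP p := by
  induction l with
  | nil => simp
  | cons a l ih =>
    rw [List.countP_cons, ← ih, List.length_cons, Finset.card_filter, Finset.sum_range_succ',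
      Finset.card_filter]
    simp

theorem PebblePath.exists_trace [DecidableEq V] {s' : Finset V × Set V} {S : Set V}
    {ms : List (PebbleMove V)} (h : PebblePath G M (∅, S) ms s') (hS : ∀ v ∈ S, IsInput G v) :
    ∃ τ : Trace G M ms.length, τ.slow ms.length = s'.2 ∧
      τ.cost 0 ms.length = ms.countP PebbleMove.isIO := by
  obtain ⟨c, h0, hT, hc⟩ := h.exists_states
  have get : ∀ t < ms.length, ∃ m, ms[t]? = some m := fun t ht => ⟨ms[t], by simp [ht]⟩
  refine ⟨{ cache := fun t => (c t).1
            slow := fun t => (c t).2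
            op := fun t => ms[t]?
            cache_zero := by rw [h0]
            slow_zero := by rw [h0]; exact hS
            card_cache_le := ?_
            cache_succ := ?_
            slow_succ := ?_
            compute_legal := fun t _ v hv => (hc t _ hv).1.2
            load_legal := fun t _ v hv => (hc t _ hv).1.2
            store_legal := fun t _ v hv => (hc t _ hv).1.2 }, congrArg Prod.snd hT, ?_⟩
  · rintro (_ | t) ht
    · simp [h0]
    · obtain ⟨m, hm⟩ := get t ht
      rw [(hc t m hm).2]
      exact (hc t m hm).1.1
  · intro t ht v hv
    obtain ⟨m, hm⟩ := get t ht
    rw [(hc t m hm).2] at hv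
    rw [hm]
    cases m <;> simp [PebbleMove.act] at hv ⊢ <;> tauto
  · intro t ht v hv
    obtain ⟨m, hm⟩ := get t ht
    rw [(hc t m hm).2] at hv
    rw [hm]
    cases m <;> simp [PebbleMove.act] at hv ⊢ <;> tauto
  · rw [Trace.cost, ← card_filter_getElem?_any, Finset.range_eq_Ico]

end Trace

/-! ### Counting -/

/-- The discrete Loomis-Whitney inequality. -/
theorem card_sq_le_mul_of_projections {α β γ : Type*} [DecidableEq α] [DecidableEq β]
    [DecidableEq γ] (X : Finset (α × β × γ)) (P : Finset (α × β)) (Q : Finset (β × γ))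
    (R : Finset (α × γ)) (hP : ∀ x ∈ X, (x.1, x.2.1) ∈ P) (hQ : ∀ x ∈ X, (x.2.1, x.2.2) ∈ Q)
    (hR : ∀ x ∈ X, (x.1, x.2.2) ∈ R) :
    X.card ^ 2 ≤ P.card * Q.card * R.card := by
  let F : α × γ → Finset (α × β × γ) := fun c => X.filter (fun x => (x.1, x.2.2) = c)
  have h1 : X.card = ∑ c ∈ R, (F c).card :=
    Finset.card_eq_sum_card_fiberwise (f := fun x : α × β × γ => (x.1, x.2.2)) fun x hx => hR x hx
  -- Two points of one fibre share their outer coordinates, so the pair is determined by the first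
  -- point's projection to `P` and the second's to `Q`. Cauchy-Schwarz over the fibres then
  -- finishes.
  have h2 : ∑ c ∈ R, (F c).card ^ 2 ≤ P.card * Q.card := by
    have e : ∑ c ∈ R, (F c).card ^ 2 = (R.sigma fun c => F c ×ˢ F c).card := by
      rw [Finset.card_sigma]
      exact Finset.sum_congr rfl fun c _ => by rw [Finset.card_product, sq]
    rw [e, ← Finset.card_product]
    refine Finset.card_le_card_of_injOn
      (fun z => ((z.2.1.1, z.2.1.2.1), (z.2.2.2.1, z.2.2.2.2))) ?_ ?_
    · rintro ⟨c, x, y⟩ hz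
      simp only [Finset.coe_sigma, Set.mem_sigma_iff, Finset.mem_coe, Finset.mem_product,
        Finset.mem_filter, F] at hz
      exact Finset.mem_coe.2 (Finset.mem_product.2 ⟨hP _ hz.2.1.1, hQ _ hz.2.2.1⟩)
    · rintro ⟨⟨a, b⟩, ⟨x1, x2, x3⟩, ⟨y1, y2, y3⟩⟩ hz ⟨⟨a', b'⟩, ⟨x1', x2', x3'⟩, ⟨y1', y2', y3'⟩⟩ hz' h
      simp only [Finset.coe_sigma, Set.mem_sigma_iff, Finset.mem_coe, Finset.mem_product,
        Finset.mem_filter, F, Prod.mk.injEq] at hz hz' h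
      obtain ⟨-, ⟨-, rfl, rfl⟩, -, rfl, rfl⟩ := hz
      obtain ⟨-, ⟨-, rfl, rfl⟩, -, rfl, rfl⟩ := hz'
      obtain ⟨⟨rfl, rfl⟩, rfl, rfl⟩ := h
      rfl
  calc X.card ^ 2 = (∑ c ∈ R, (F c).card) ^ 2 := by rw [h1]
    _ ≤ R.card * ∑ c ∈ R, (F c).card ^ 2 := sq_sum_le_card_mul_sum_sq
    _ ≤ R.card * (P.card * Q.card) := by gcongr
    _ = P.card * Q.card * R.card := by ring

/-- The triples `(i, m, j)` such that both operands of the `L`-vertex of `S(i,j)` which splits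
`S(i,j)` into `S(i,m)` and `S(m+1,j)` have length more than `r`. -/
def longTriples (n r : ℕ) : Finset (ℕ × ℕ × ℕ) :=
  (Finset.range (n + 1) ×ˢ Finset.range (n + 1) ×ˢ Finset.range (n + 1)).filter
    (fun x => 1 ≤ x.1 ∧ x.1 + r ≤ x.2.1 ∧ x.2.1 + 1 + r ≤ x.2.2 ∧ x.2.2 ≤ n)

theorem mem_longTriples {n r : ℕ} {x : ℕ × ℕ × ℕ} :
    x ∈ longTriples n r ↔
      1 ≤ x.1 ∧ x.1 + r ≤ x.2.1 ∧ x.2.1 + 1 + r ≤ x.2.2 ∧ x.2.2 ≤ n := by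
  simp only [longTriples, Finset.mem_filter, Finset.mem_product, Finset.mem_range]
  omega

theorem six_mul_sum_range_sum_range (N : ℕ) :
    (6 * ((∑ c ∈ Finset.range (N + 1), ∑ b ∈ Finset.range c, b : ℕ) : ℝ)) =
      (N + 1) * N * (N - 1) := by
  have h (c : ℕ) : (2 * ((∑ b ∈ Finset.range c, b : ℕ) : ℝ)) = c * (c - 1) := by
    induction c with
    | zero => simp
    | succ c ih => rw [Finset.sum_range_succ]; push_cast at ih ⊢; linarith
  induction N with
  | zero => simp
  | succ N ih =>
    rw [Finset.sum_range_succ]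
    have := h (N + 1)
    push_cast at ih this ⊢
    linarith

/-- With `N = n - 2 * r - 1`, spreading triples `a < b < c ≤ N + 1` apart by `r` gives long triples,
and there are `(N + 2) * (N + 1) * N / 6` of the former. -/
theorem cube_le_card_longTriples {n r : ℕ} (h : 2 * r + 1 ≤ n) :
    ((n : ℝ) - 2 * r - 1) ^ 3 ≤ 6 * (longTriples n r).card := by
  obtain ⟨N, rfl⟩ : ∃ N, n = 2 * r + (N + 1) := ⟨n - (2 * r + 1), by omega⟩
  have hle : (∑ c ∈ Finset.range (N + 1 + 1), ∑ b ∈ Finset.range c, b) ≤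
      (longTriples (2 * r + (N + 1)) r).card := by
    have e : (∑ c ∈ Finset.range (N + 1 + 1), ∑ b ∈ Finset.range c, b) =
        ((Finset.range (N + 1 + 1)).sigma fun c =>
          (Finset.range c).sigma fun b => Finset.range b).card := by
      simp [Finset.card_sigma]
    rw [e]
    refine Finset.card_le_card_of_injOn
      (fun z => (z.2.2 + 1, z.2.1 + r, z.1 + 2 * r)) ?_ ?_
    · rintro ⟨c, b, a⟩ hz
      simp only [Finset.coe_sigma, Set.mem_sigma_iff, Finset.mem_coe, Finset.mem_range] at hz
      rw [Finset.mem_coe, mem_longTriples]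
      dsimp only
      omega
    · rintro ⟨c, b, a⟩ - ⟨c', b', a'⟩ - h
      simp only [Prod.mk.injEq, Nat.add_right_cancel_iff] at h
      obtain ⟨rfl, rfl, rfl⟩ := h
      rfl
  have h6 := six_mul_sum_range_sum_range (N + 1)
  have hle' : ((∑ c ∈ Finset.range (N + 1 + 1), ∑ b ∈ Finset.range c, b : ℕ) : ℝ) ≤
      (longTriples (2 * r + (N + 1)) r).card := by exact_mod_cast hle
  have hN : (0 : ℝ) ≤ N := Nat.cast_nonneg N
  calc _ = (N : ℝ) ^ 3 := by push_cast; ring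
    _ ≤ ((N + 1 : ℕ) + 1) * (N + 1 : ℕ) * ((N + 1 : ℕ) - 1) := by push_cast; nlinarith [sq_nonneg (N : ℝ)]
    _ ≤ _ := by linarith

/-- A function on `ℕ` with increments at most one takes all intermediate values. -/
theorem exists_eq_of_le_of_succ_le {f : ℕ → ℕ} (h0 : f 0 = 0) (h : ∀ t, f (t + 1) ≤ f t + 1)
    {k e : ℕ} (hk : k ≤ f e) : ∃ s ≤ e, f s = k := by
  induction e with
  | zero => exact ⟨0, le_rfl, by omega⟩
  | succ e ih =>
    by_cases hk' : k ≤ f e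
    · obtain ⟨s, hs, rfl⟩ := ih hk'
      exact ⟨s, by omega, rfl⟩
    · exact ⟨e + 1, le_rfl, by have := h e; omega⟩

/-! ### Liveness -/

namespace Trace

variable {V : Type u} {G : Digraph V} {M T : ℕ}

/-- Backward liveness analysis. `τ.Live o true t v` (`τ.Live o false t v`) says that the copy of the
value `v` in the cache (in the slow memory) at time `t` contributes to the presence of the
value `o` in the slow memory at the end. -/
inductive Live (τ : Trace G M T) (o : V) : Bool → ℕ → V → Prop
  | final : Live τ o false T o
  | keep {t v} : t < T → Live τ o true (t + 1) v → τ.op t ≠ some (.compute v) →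
      τ.op t ≠ some (.load v) → Live τ o true t v
  | operand {t u v} : t < T → τ.op t = some (.compute v) → Live τ o true (t + 1) v →
      G.Adj u v → Live τ o true t u
  | load {t v} : t < T → τ.op t = some (.load v) → Live τ o true (t + 1) v → Live τ o false t v
  | keepSlow {t v} : t < T → Live τ o false (t + 1) v → τ.op t ≠ some (.store v) →
      Live τ o false t v
  | store {t v} : t < T → τ.op t = some (.store v) → Live τ o false (t + 1) v →
      Live τ o true t v

/-- At time `t` the value `v` is computed, and the result contributes to the final output. -/
def Useful (τ : Trace G M T) (o : V) (t : ℕ) (v : V) : Prop :=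
  t < T ∧ τ.op t = some (.compute v) ∧ τ.Live o true (t + 1) v

variable {τ : Trace G M T} {o : V}

theorem Live.le {b : Bool} {t : ℕ} {v : V} (h : τ.Live o b t v) : t ≤ T := by
  cases h <;> omega

/-- Each rule goes one move back: either the move created no new copy, so the copy was already
there, or legality puts its source in place. -/
theorem Live.mem (ho : o ∈ τ.slow T) {b : Bool} {t : ℕ} {v : V} (h : τ.Live o b t v) :
    bif b then v ∈ τ.cache t else v ∈ τ.slow t := by
  induction h with
  | final => exact ho
  | keep ht _ hc hl ih => rcases τ.cache_succ _ ht _ ih with h | h | h <;> first | exact h | contradiction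
  | operand ht hc _ ha _ => exact (τ.compute_legal _ ht _ hc).2 _ ha
  | load ht hl _ _ => exact τ.load_legal _ ht _ hl
  | keepSlow ht _ hs ih => rcases τ.slow_succ _ ht _ ih with h | h <;> first | exact h | contradiction
  | store ht hs _ _ => exact τ.store_legal _ ht _ hs

theorem Live.mem_cache (ho : o ∈ τ.slow T) {t : ℕ} {v : V} (h : τ.Live o true t v) :
    v ∈ τ.cache t := h.mem ho

/-- A live value that is no input has been computed before. -/
theorem Live.exists_useful (ho : o ∈ τ.slow T) {b : Bool} {t : ℕ} {v : V} (h : τ.Live o b t v)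
    (hv : ¬ IsInput G v) : ∃ t', τ.Useful o t' v := by
  induction t generalizing b with
  | zero =>
    have := h.mem ho
    cases b
    · exact absurd (τ.slow_zero v this) hv
    · simp [τ.cache_zero] at this
  -- The copy is followed back in time until a computation is met; at time `0` only inputs are
  -- present.
  | succ t ih =>
    have ht : t < T := h.le
    cases b
    · by_cases hs : τ.op t = some (.store v)
      · exact ih (.store ht hs h)
      · exact ih (.keepSlow ht h hs)
    · by_cases hc : τ.op t = some (.compute v)
      · exact ⟨t, ht, hc, h⟩
      by_cases hl : τ.op t = some (.load v)
      · exact ih (.load ht hl h)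
      · exact ih (.keep ht h hc hl)

/-- A live value in the cache stays there, is stored, or is used. -/
theorem Live.exists_use (ho : o ∈ τ.slow T) {t e : ℕ} {v : V} (hte : t ≤ e)
    (h : τ.Live o true t v) :
    v ∈ τ.cache e ∨ (∃ t', t ≤ t' ∧ t' < e ∧ τ.op t' = some (.store v)) ∨
      ∃ t' w, t ≤ t' ∧ t' < e ∧ G.Adj v w ∧ τ.Useful o t' w := by
  obtain ⟨d, rfl⟩ := Nat.exists_eq_add_of_le hte
  induction d generalizing t with
  | zero => exact Or.inl (h.mem_cache ho)
  | succ d ih =>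
    cases h with
    | keep ht h hc hl =>
      have := ih (t := t + 1) h (by omega)
      rw [show t + 1 + d = t + (d + 1) by ring] at this
      rcases this with h | ⟨t', h1, h2⟩ | ⟨t', w, h1, h2⟩
      · exact Or.inl h
      · exact Or.inr (Or.inl ⟨t', by omega, h2⟩)
      · exact Or.inr (Or.inr ⟨t', w, by omega, h2⟩)
    | operand ht hc h ha => exact Or.inr (Or.inr ⟨t, _, le_rfl, by omega, ha, ht, hc, h⟩)
    | store ht hs h => exact Or.inr (Or.inl ⟨t, le_rfl, by omega, hs⟩)

/-- The value `v` contributes to the output. -/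
def Needed (τ : Trace G M T) (o v : V) : Prop := ∃ b t, τ.Live o b t v

theorem Needed.exists_useful (ho : o ∈ τ.slow T) {v : V} (h : τ.Needed o v)
    (hv : ¬ IsInput G v) : ∃ t, τ.Useful o t v := by
  obtain ⟨b, t, h⟩ := h
  exact h.exists_useful ho hv

/-- A vertex with a predecessor is no input, so it is usefully computed, and its operands are live
at that moment. -/
theorem Needed.of_adj (ho : o ∈ τ.slow T) {u v : V} (h : τ.Needed o v) (ha : G.Adj u v) :
    τ.Needed o u := by
  obtain ⟨t, ht, hc, hl⟩ := h.exists_useful ho (fun hv => hv u ha)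
  exact ⟨true, t, .operand ht hc hl ha⟩

/-! ### Transfers in a time interval -/

theorem cost_add (τ : Trace G M T) {s t e : ℕ} (hs : s ≤ t) (ht : t ≤ e) :
    τ.cost s t + τ.cost t e = τ.cost s e := by
  simp only [cost, Finset.card_filter]
  exact Finset.sum_Ico_consecutive _ hs ht

theorem cost_succ_le (τ : Trace G M T) (t : ℕ) : τ.cost 0 (t + 1) ≤ τ.cost 0 t + 1 := by
  rw [← τ.cost_add (Nat.zero_le t) (Nat.le_add_right t 1)]
  have : τ.cost t (t + 1) ≤ 1 := (Finset.card_filter_le _ _).trans (by simp)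
  omega

/-- The value that is loaded by a move. -/
def loadedBy : Option (PebbleMove V) → Finset V
  | some (.load v) => {v}
  | _ => ∅

/-- The value that is stored by a move. -/
def storedBy : Option (PebbleMove V) → Finset V
  | some (.store v) => {v}
  | _ => ∅

variable [DecidableEq V]

/-- The values loaded in the time interval `[s, e)`. -/
def loaded (τ : Trace G M T) (s e : ℕ) : Finset V :=
  (Finset.Ico s e).biUnion fun t => loadedBy (τ.op t)

/-- The values stored in the time interval `[s, e)`. -/
def stored (τ : Trace G M T) (s e : ℕ) : Finset V :=
  (Finset.Ico s e).biUnion fun t => storedBy (τ.op t)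

theorem mem_loaded {s e t : ℕ} {v : V} (hs : s ≤ t) (he : t < e)
    (h : τ.op t = some (.load v)) : v ∈ τ.loaded s e :=
  Finset.mem_biUnion.2 ⟨t, Finset.mem_Ico.2 ⟨hs, he⟩, by simp [h, loadedBy]⟩

theorem mem_stored {s e t : ℕ} {v : V} (hs : s ≤ t) (he : t < e)
    (h : τ.op t = some (.store v)) : v ∈ τ.stored s e :=
  Finset.mem_biUnion.2 ⟨t, Finset.mem_Ico.2 ⟨hs, he⟩, by simp [h, storedBy]⟩

/-- A move loads or stores at most one value, never both, so loads and stores share one budget. -/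
theorem card_loaded_add_card_stored_le (τ : Trace G M T) (s e : ℕ) :
    (τ.loaded s e).card + (τ.stored s e).card ≤ τ.cost s e := by
  rw [cost, Finset.card_filter]
  refine (add_le_add Finset.card_biUnion_le Finset.card_biUnion_le).trans ?_
  rw [← Finset.sum_add_distrib]
  refine Finset.sum_le_sum fun t _ => ?_
  rcases τ.op t with _ | (_ | _ | _ | _) <;> simp [loadedBy, storedBy, PebbleMove.isIO]

/-- A value in the cache was there at the beginning of the interval, or has been loaded or computed
since. -/
theorem mem_cache_cases (τ : Trace G M T) {s t e : ℕ} {v : V} (hst : s ≤ t) (hte : t ≤ e)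
    (he : e ≤ T) (h : v ∈ τ.cache t) :
    v ∈ τ.cache s ∪ τ.loaded s e ∨
      ∃ t', s ≤ t' ∧ t' < e ∧ τ.op t' = some (.compute v) := by
  induction t, hst using Nat.le_induction with
  | base => exact Or.inl (Finset.mem_union_left _ h)
  | succ t hst ih =>
    rcases τ.cache_succ t (by omega) v h with h | h | h
    · exact ih (by omega) h
    · exact Or.inr ⟨t, hst, by omega, h⟩
    · exact Or.inl (Finset.mem_union_right _ (mem_loaded hst (by omega) h))

end Trace

/-! ### The structure of the trees -/

namespace Decomposition

variable {V : Type u} {n : ℕ} {G : Digraph V} (D : Decomposition n G)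

/-- The subproblem to whose tree a vertex belongs. -/
def sub (v : V) : ℕ × ℕ := (D.lo v, D.hi v)

theorem sub_root {i j : ℕ} (hi : 1 ≤ i) (hij : i ≤ j) (hj : j ≤ n) : D.sub (D.root i j) = (i, j) :=
  Prod.ext (D.root_mem i j hi hij hj).1 (D.root_mem i j hi hij hj).2

theorem sub_leaf {i j k : ℕ} (hi : 1 ≤ i) (hj : j ≤ n) (hk : k < j - i) :
    D.sub (D.leaf i j k) = (i, j) :=
  Prod.ext (D.leaf_mem i j k hi hj hk).1 (D.leaf_mem i j k hi hj hk).2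

theorem isInput_of_lo_eq_hi {v : V} (h : D.lo v = D.hi v) : IsInput G v := by
  intro u hu
  by_cases hs : D.lo u = D.lo v ∧ D.hi u = D.hi v
  · have e : u = v := by
      rw [D.singleton v h, D.singleton u (by omega), hs.1, hs.2]
    subst e
    have hr := D.range u
    have := D.root_top (D.lo u) (D.hi u) u hr.1 hr.2.1 hr.2.2
    rw [← D.singleton u h] at this
    exact this hu ⟨rfl, rfl⟩
  · obtain ⟨i, j, k, hi, hj, hk, rfl, -⟩ := (D.cross u v hs).1 hu
    obtain ⟨h1, h2⟩ := D.leaf_mem i j k hi hj hk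
    omega

theorem isInput_root {i : ℕ} (hi : 1 ≤ i) (hn : i ≤ n) : IsInput G (D.root i i) := by
  obtain ⟨h1, h2⟩ := D.root_mem i i hi le_rfl hn
  exact D.isInput_of_lo_eq_hi (h1.trans h2.symm)

theorem adj_left {i m j : ℕ} (hi : 1 ≤ i) (him : i ≤ m) (hmj : m < j) (hj : j ≤ n) :
    G.Adj (D.root i m) (D.leaf i j (m - i)) := by
  obtain ⟨h1, h2⟩ := D.root_mem i m hi him (by omega)
  obtain ⟨h3, h4⟩ := D.leaf_mem i j (m - i) hi hj (by omega)
  refine (D.cross _ _ (by omega)).2 ⟨i, j, m - i, hi, hj, by omega, rfl, Or.inl ?_⟩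
  rw [Nat.add_sub_cancel' him]

theorem adj_right {i m j : ℕ} (hi : 1 ≤ i) (him : i ≤ m) (hmj : m < j) (hj : j ≤ n) :
    G.Adj (D.root (m + 1) j) (D.leaf i j (m - i)) := by
  obtain ⟨h1, h2⟩ := D.root_mem (m + 1) j (by omega) hmj hj
  obtain ⟨h3, h4⟩ := D.leaf_mem i j (m - i) hi hj (by omega)
  refine (D.cross _ _ (by omega)).2 ⟨i, j, m - i, hi, hj, by omega, rfl, Or.inr ?_⟩
  rw [Nat.add_sub_cancel' him]

theorem not_isInput_leaf {i m j : ℕ} (hi : 1 ≤ i) (him : i ≤ m) (hmj : m < j) (hj : j ≤ n) :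
    ¬ IsInput G (D.leaf i j (m - i)) := fun h => h _ (D.adj_left hi him hmj hj)

/-- Edges between trees start at roots: a tree can pass values on only through its root. -/
theorem sub_eq_of_adj {v w : V} (hv : v ≠ D.root (D.lo v) (D.hi v)) (h : G.Adj v w) :
    D.sub w = D.sub v := by
  by_contra hne
  have hne' : ¬ (D.lo v = D.lo w ∧ D.hi v = D.hi w) := fun h => hne (Prod.ext h.1.symm h.2.symm)
  obtain ⟨i, j, k, hi, hj, hk, -, rfl | rfl⟩ := (D.cross v w hne').1 h
  · obtain ⟨h1, h2⟩ := D.root_mem i (i + k) hi (by omega) (by omega)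
    rw [h1, h2] at hv
    exact hv rfl
  · obtain ⟨h1, h2⟩ := D.root_mem (i + k + 1) j (by omega) (by omega) hj
    rw [h1, h2] at hv
    exact hv rfl

theorem isOutput_root : 1 ≤ n → IsOutput G (D.root 1 n) := by
  intro hn w hw
  obtain ⟨h1, h2⟩ := D.root_mem 1 n le_rfl hn le_rfl
  by_cases hs : D.lo w = 1 ∧ D.hi w = n
  · exact D.root_top 1 n w le_rfl hn le_rfl hw hs
  · obtain ⟨i, j, k, hi, hj, hk, -, h | h⟩ := (D.cross _ w (by omega)).1 hw
    · obtain ⟨h3, h4⟩ := D.root_mem i (i + k) hi (by omega) (by omega)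
      rw [← h] at h3 h4
      omega
    · obtain ⟨h3, h4⟩ := D.root_mem (i + k + 1) j (by omega) (by omega) hj
      rw [← h] at h3 h4
      omega

/-- A property of the root of a tree that passes to predecessors in the tree holds on the
whole tree. -/
theorem of_root {p : V → Prop} {i j : ℕ} (h0 : p (D.root i j))
    (h : ∀ u w, G.Adj u w → D.sub u = (i, j) → D.sub w = (i, j) → p w → p u) {v : V}
    (hv : D.sub v = (i, j)) : p v := by
  have hr := D.reach v
  obtain ⟨rfl, rfl⟩ : D.lo v = i ∧ D.hi v = j := ⟨congrArg Prod.fst hv, congrArg Prod.snd hv⟩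
  have : D.sub v = (D.lo v, D.hi v) → p v := by
    generalize D.lo v = i at *
    generalize D.hi v = j at *
    induction hr using Relation.ReflTransGen.head_induction_on with
    | refl => exact fun _ => h0
    | @head u w huw _ ih =>
      intro hu
      have hw : D.sub w = (i, j) := by rw [← hu]; exact Prod.ext huw.2.1 huw.2.2
      exact h u w huw.1 hu hw (ih hw hw)
  exact this hv

end Decomposition

/-! ### Supply and survival of subproblems in a segment -/

namespace Trace

variable {V : Type u} {n : ℕ} {G : Digraph V} {M T : ℕ} {τ : Trace G M T} {o : V}

theorem needed_of_needed_root (D : Decomposition n G) (ho : o ∈ τ.slow T) {i j : ℕ}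
    (h : τ.Needed o (D.root i j)) {v : V} (hv : D.sub v = (i, j)) : τ.Needed o v :=
  D.of_root h (fun _ _ ha _ _ hw => hw.of_adj ho ha) hv

/-- `S(i,n)` is a right operand in `S(1,n)`, and `S(i,j)` is a left operand in `S(i,n)`. -/
theorem needed_root (D : Decomposition n G) (ho : D.root 1 n ∈ τ.slow T) {i j : ℕ} (hi : 1 ≤ i)
    (hij : i ≤ j) (hj : j ≤ n) : τ.Needed (D.root 1 n) (D.root i j) := by
  have h1n : τ.Needed (D.root 1 n) (D.root 1 n) := ⟨false, T, .final⟩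
  have hin : τ.Needed (D.root 1 n) (D.root i n) := by
    rcases hi.eq_or_lt with rfl | h
    · exact h1n
    · have hl := needed_of_needed_root D ho h1n
        (D.sub_leaf (i := 1) (j := n) (k := i - 1 - 1) le_rfl le_rfl (by omega))
      have := D.adj_right (i := 1) (m := i - 1) (j := n) le_rfl (by omega) (by omega) le_rfl
      rw [Nat.sub_add_cancel hi] at this
      exact hl.of_adj ho this
  rcases hj.eq_or_lt with rfl | h
  · exact hin
  · exact (needed_of_needed_root D ho hin
      (D.sub_leaf (i := i) (j := n) (k := j - i) hi le_rfl (by omega))).of_adj ho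
        (D.adj_left hi hij h le_rfl)

theorem exists_useful_leaf (D : Decomposition n G) (ho : D.root 1 n ∈ τ.slow T) {i m j : ℕ}
    (hi : 1 ≤ i) (him : i ≤ m) (hmj : m < j) (hj : j ≤ n) :
    ∃ t, τ.Useful (D.root 1 n) t (D.leaf i j (m - i)) :=
  (needed_of_needed_root D ho (needed_root D ho hi (by omega) hj)
    (D.sub_leaf hi hj (by omega))).exists_useful ho (D.not_isInput_leaf hi him hmj hj)

/-- If a vertex of a tree is usefully computed, then some value of the tree survives the
interval, or the root of the tree is usefully computed in the interval. -/
theorem Useful.survives_or_root (D : Decomposition n G) (ho : o ∈ τ.slow T) {t e : ℕ} {v : V}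
    (hte : t < e) (h : τ.Useful o t v) :
    (∃ x, D.sub x = D.sub v ∧
      (x ∈ τ.cache e ∨ ∃ t', t ≤ t' ∧ t' < e ∧ τ.op t' = some (.store x))) ∨
    ∃ t', t ≤ t' ∧ t' < e ∧ τ.Useful o t' (D.root (D.lo v) (D.hi v)) := by
  -- A non-root value that neither stays nor is stored is used at a later time by a vertex of the
  -- same tree, so the remaining time decreases.
  induction hd : e - t using Nat.strong_induction_on generalizing t v with
  | _ d ih =>
    by_cases hv : v = D.root (D.lo v) (D.hi v)
    · exact Or.inr ⟨t, le_rfl, hte, hv ▸ h⟩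
    rcases h.2.2.exists_use ho (e := e) hte with h | ⟨t', h1, h2, h3⟩ | ⟨t', w, h1, h2, ha, hw⟩
    · exact Or.inl ⟨v, rfl, Or.inl h⟩
    · exact Or.inl ⟨v, rfl, Or.inr ⟨t', by omega, h2, h3⟩⟩
    · have hs := D.sub_eq_of_adj hv ha
      have hlo : D.lo w = D.lo v := congrArg Prod.fst hs
      have hhi : D.hi w = D.hi v := congrArg Prod.snd hs
      rcases ih (e - t') (by omega) h2 hw rfl with ⟨x, hx, h⟩ | ⟨t'', h3, h4, h5⟩
      · refine Or.inl ⟨x, hx.trans hs, h.imp_right ?_⟩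
        rintro ⟨t'', h3, h4, h5⟩
        exact ⟨t'', by omega, h4, h5⟩
      · exact Or.inr ⟨t'', by omega, h4, by rwa [hlo, hhi] at h5⟩

variable [DecidableEq V]

/-- The subproblems that have a value which is in the cache at the beginning of the interval or is
loaded in the interval. -/
def supply (τ : Trace G M T) (D : Decomposition n G) (s e : ℕ) : Finset (ℕ × ℕ) :=
  (τ.cache s ∪ τ.loaded s e).image D.sub

/-- The subproblems that have a value which is in the cache at the end of the interval or is
stored in the interval. -/
def survivors (τ : Trace G M T) (D : Decomposition n G) (s e : ℕ) : Finset (ℕ × ℕ) :=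
  (τ.cache e ∪ τ.stored s e).image D.sub

/-- Bounding the sum, with the transfers counted once, is what yields `4 * M` for the union when the
cost is at most `2 * M`. -/
theorem card_supply_add_card_survivors_le (τ : Trace G M T) (D : Decomposition n G) {s e : ℕ}
    (hse : s ≤ e) (he : e ≤ T) :
    (τ.supply D s e).card ≤ M + τ.cost s e ∧
      (τ.supply D s e).card + (τ.survivors D s e).card ≤ 2 * M + τ.cost s e := by
  have h1 : (τ.supply D s e).card ≤ (τ.cache s).card + (τ.loaded s e).card :=
    Finset.card_image_le.trans (Finset.card_union_le _ _)
  have h2 : (τ.survivors D s e).card ≤ (τ.cache e).card + (τ.stored s e).card :=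
    Finset.card_image_le.trans (Finset.card_union_le _ _)
  have h3 := τ.card_cache_le s (by omega)
  have h4 := τ.card_cache_le e he
  have h5 := τ.card_loaded_add_card_stored_le s e
  omega

/-- The value `v` is in the cache at some time of the interval `[s, e]`. -/
def Accessed (τ : Trace G M T) (s e : ℕ) (v : V) : Prop := ∃ t, s ≤ t ∧ t ≤ e ∧ v ∈ τ.cache t

/-- Without supply from its tree, the value must be computed inside the interval, with its operands
in the cache. -/
theorem Accessed.of_adj {D : Decomposition n G} {s e : ℕ} (he : e ≤ T) {u v : V}
    (h : τ.Accessed s e v) (hv : D.sub v ∉ τ.supply D s e) (ha : G.Adj u v) :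
    τ.Accessed s e u := by
  obtain ⟨t, hst, hte, ht⟩ := h
  rcases τ.mem_cache_cases hst hte he ht with h | ⟨t', h1, h2, h3⟩
  · exact absurd (Finset.mem_image_of_mem _ h) hv
  · exact ⟨t', h1, by omega, (τ.compute_legal t' (by omega) v h3).2 u ha⟩

theorem Accessed.sub_mem_supply_of_isInput {D : Decomposition n G} {s e : ℕ} (he : e ≤ T) {v : V}
    (h : τ.Accessed s e v) (hv : IsInput G v) : D.sub v ∈ τ.supply D s e := by
  obtain ⟨t, hst, hte, ht⟩ := h
  rcases τ.mem_cache_cases hst hte he ht with h | ⟨t', h1, h2, h3⟩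
  · exact Finset.mem_image_of_mem _ h
  · exact absurd hv (τ.compute_legal t' (by omega) v h3).1

/-- If the root of a tree is accessed without supply from this tree, then so are the operands of
all its leaves. -/
theorem Accessed.operands {D : Decomposition n G} {s e : ℕ} (he : e ≤ T) {i m j : ℕ}
    (hi : 1 ≤ i) (him : i ≤ m) (hmj : m < j) (hj : j ≤ n) (h : τ.Accessed s e (D.root i j))
    (hs : (i, j) ∉ τ.supply D s e) :
    τ.Accessed s e (D.root i m) ∧ τ.Accessed s e (D.root (m + 1) j) := by
  have hsub := D.sub_leaf (k := m - i) hi hj (by omega)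
  have hl : τ.Accessed s e (D.leaf i j (m - i)) :=
    D.of_root h (fun u w ha _ hw hp => hp.of_adj (D := D) he (by rwa [hw]) ha) hsub
  exact ⟨hl.of_adj (D := D) he (by rwa [hsub]) (D.adj_left hi him hmj hj),
    hl.of_adj (D := D) he (by rwa [hsub]) (D.adj_right hi him hmj hj)⟩

/-- An accessed root of a large subproblem belongs to a supplied tree. -/
theorem Accessed.mem_supply {D : Decomposition n G} {s e : ℕ} (he : e ≤ T) {i j : ℕ}
    (hi : 1 ≤ i) (hij : i ≤ j) (hj : j ≤ n) (h : τ.Accessed s e (D.root i j))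
    (hlong : (τ.supply D s e).card ≤ j - i) : (i, j) ∈ τ.supply D s e := by
  by_contra hs
  have input {m : ℕ} (h1 : 1 ≤ m) (h2 : m ≤ n) (h : τ.Accessed s e (D.root m m)) :
      (m, m) ∈ τ.supply D s e := by
    have := h.sub_mem_supply_of_isInput (D := D) he (D.isInput_root h1 h2)
    rwa [D.sub_root h1 le_rfl h2] at this
  -- An accessed root of `S(i,m)` forces some supplied subproblem ending at `m`: itself, or else the
  -- input `m`, the right operand of its last leaf.
  have last {m : ℕ} (h1 : i ≤ m) (h2 : m ≤ n) (h : τ.Accessed s e (D.root i m)) :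
      ∃ k, (k, m) ∈ τ.supply D s e := by
    by_cases hm : (i, m) ∈ τ.supply D s e
    · exact ⟨_, hm⟩
    refine ⟨m, input (by omega) h2 ?_⟩
    rcases h1.eq_or_lt with rfl | hlt
    · exact h
    · have := (h.operands he hi (m := m - 1) (by omega) (by omega) h2 hm).2
      rwa [Nat.sub_add_cancel (by omega)] at this
  -- The supplied subproblems would thus have `j - i + 1` distinct right ends, more than there are
  -- subproblems.
  have hsub : Finset.Icc i j ⊆ (τ.supply D s e).image Prod.snd := by
    intro m hm
    obtain ⟨h1, h2⟩ := Finset.mem_Icc.1 hm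
    have ha : τ.Accessed s e (D.root i m) := by
      rcases h2.eq_or_lt with rfl | hlt
      · exact h
      · exact (h.operands he hi h1 hlt hj hs).1
    obtain ⟨k, hk⟩ := last h1 (by omega) ha
    exact Finset.mem_image.2 ⟨_, hk, rfl⟩
  have := (Finset.card_le_card hsub).trans Finset.card_image_le
  rw [Nat.card_Icc] at this
  omega

/-- In an interval with at most `2 * M` transfers few leaves with long operands are usefully
computed. -/
theorem card_sq_le_of_cost_le (D : Decomposition n G) (ho : o ∈ τ.slow T) {s e : ℕ} (hse : s ≤ e)
    (he : e ≤ T) (hcost : τ.cost s e ≤ 2 * M) {X : Finset (ℕ × ℕ × ℕ)}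
    (hX : X ⊆ longTriples n (3 * M))
    (hu : ∀ x ∈ X, ∃ t, s ≤ t ∧ t < e ∧ τ.Useful o t (D.leaf x.1 x.2.2 (x.2.1 - x.1))) :
    X.card ^ 2 ≤ 36 * M ^ 3 := by
  obtain ⟨hS, hSE⟩ := τ.card_supply_add_card_survivors_le D hse he
  have acc {x : ℕ × ℕ × ℕ} (hx : x ∈ X) {u : V}
      (ha : G.Adj u (D.leaf x.1 x.2.2 (x.2.1 - x.1))) : τ.Accessed s e u := by
    obtain ⟨t, h1, h2, h3, h4, -⟩ := hu x hx
    exact ⟨t, h1, h2.le, (τ.compute_legal t h3 _ h4).2 u ha⟩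
  -- The right operand is `S(m+1,j)`; shifting its left end by one gives the face `(m, j)`.
  have key := card_sq_le_mul_of_projections X (τ.supply D s e)
    ((τ.supply D s e).image fun p => (p.1 - 1, p.2)) (τ.supply D s e ∪ τ.survivors D s e) ?_ ?_ ?_
  · have h1 : ((τ.supply D s e).image fun p => (p.1 - 1, p.2)).card ≤ 3 * M :=
      Finset.card_image_le.trans (by omega)
    have h2 : (τ.supply D s e ∪ τ.survivors D s e).card ≤ 4 * M :=
      (Finset.card_union_le _ _).trans (by omega)
    have h3 : (τ.supply D s e).card ≤ 3 * M := by omega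
    calc X.card ^ 2 ≤ _ := key
      _ ≤ 3 * M * (3 * M) * (4 * M) := by gcongr
      _ = 36 * M ^ 3 := by ring
  · intro x hx
    obtain ⟨h1, h2, h3, h4⟩ := mem_longTriples.1 (hX hx)
    exact (acc hx (D.adj_left h1 (by omega) (by omega) h4)).mem_supply he h1 (by omega) (by omega)
      (by omega)
  · intro x hx
    obtain ⟨h1, h2, h3, h4⟩ := mem_longTriples.1 (hX hx)
    exact Finset.mem_image.2 ⟨_, (acc hx (D.adj_right h1 (by omega) (by omega) h4)).mem_supply he
      (by omega) (by omega) h4 (by omega), rfl⟩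
  · intro x hx
    obtain ⟨h1, h2, h3, h4⟩ := mem_longTriples.1 (hX hx)
    obtain ⟨t, hst, hte, h⟩ := hu x hx
    have hsub := D.sub_leaf (k := x.2.1 - x.1) h1 h4 (by omega)
    rcases h.survives_or_root D ho hte with ⟨y, hy, hy'⟩ | ⟨t', h5, h6, h7⟩
    · refine Finset.mem_union_right _ (Finset.mem_image.2 ⟨y, ?_, hy.trans hsub⟩)
      rcases hy' with hy' | ⟨t', h5, h6, h7⟩
      · exact Finset.mem_union_left _ hy'
      · exact Finset.mem_union_right _ (mem_stored (by omega) h6 h7)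
    · have hlo := (D.leaf_mem x.1 x.2.2 (x.2.1 - x.1) h1 h4 (by omega)).1
      have hhi := (D.leaf_mem x.1 x.2.2 (x.2.1 - x.1) h1 h4 (by omega)).2
      rw [hlo, hhi] at h7
      have ha : τ.Accessed s e (D.root x.1 x.2.2) :=
        ⟨t' + 1, by omega, h6, h7.2.2.mem_cache ho⟩
      exact Finset.mem_union_left _ (ha.mem_supply he h1 (by omega) h4 (by omega))

theorem card_le_of_cost_le (D : Decomposition n G) (ho : o ∈ τ.slow T) (q : ℕ) {e : ℕ}
    (he : e ≤ T) (hcost : τ.cost 0 e ≤ 2 * M * (q + 1)) {X : Finset (ℕ × ℕ × ℕ)}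
    (hX : X ⊆ longTriples n (3 * M))
    (hu : ∀ x ∈ X, ∃ t < e, τ.Useful o t (D.leaf x.1 x.2.2 (x.2.1 - x.1))) :
    (X.card : ℝ) ≤ (q + 1) * (6 * M * √M) := by
  classical
  have seg {s e : ℕ} (hse : s ≤ e) (he : e ≤ T) (hcost : τ.cost s e ≤ 2 * M)
      {X : Finset (ℕ × ℕ × ℕ)} (hX : X ⊆ longTriples n (3 * M))
      (hu : ∀ x ∈ X, ∃ t, s ≤ t ∧ t < e ∧ τ.Useful o t (D.leaf x.1 x.2.2 (x.2.1 - x.1))) :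
      (X.card : ℝ) ≤ 6 * M * √M := by
    have h : ((X.card : ℝ)) ^ 2 ≤ 36 * M ^ 3 := by
      exact_mod_cast card_sq_le_of_cost_le D ho hse he hcost hX hu
    refine le_of_sq_le_sq (h.trans_eq ?_) (by positivity)
    rw [mul_pow, Real.sq_sqrt (Nat.cast_nonneg M)]
    ring
  induction q generalizing e X with
  | zero =>
    simpa using seg (Nat.zero_le e) he (by simpa using hcost) hX
      (fun x hx => (hu x hx).imp fun t ht => ⟨Nat.zero_le t, ht⟩)
  | succ q ih =>
    -- The last segment is cut off where `2 * M` transfers remain; by truncated subtraction it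
    -- starts at cost `0` if there are fewer.
    obtain ⟨s, hse, hs⟩ := exists_eq_of_le_of_succ_le (f := fun t => τ.cost 0 t)
      (by simp [cost]) τ.cost_succ_le (k := τ.cost 0 e - 2 * M) (e := e) (by simp)
    have hadd := τ.cost_add (Nat.zero_le s) hse
    -- A triple whose leaf is usefully computed on both sides of `s` is charged to the earlier part
    -- only.
    set p : ℕ × ℕ × ℕ → Prop :=
      fun x => ∃ t < s, τ.Useful o t (D.leaf x.1 x.2.2 (x.2.1 - x.1)) with hp
    have h1 := ih (e := s) (X := X.filter p) (by omega)
      (by rw [hs]; rw [mul_add _ (_ : ℕ) 1] at hcost; omega)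
      ((Finset.filter_subset _ _).trans hX) (fun x hx => (Finset.mem_filter.1 hx).2)
    have h2 := seg (s := s) (e := e) (X := X.filter fun x => ¬ p x) hse he (by omega)
      ((Finset.filter_subset _ _).trans hX) (fun x hx => by
        obtain ⟨hx, hpx⟩ := Finset.mem_filter.1 hx
        obtain ⟨t, ht, h⟩ := hu x hx
        exact ⟨t, not_lt.1 fun hts => hpx ⟨t, hts, h⟩, ht, h⟩)
    have h3 : ((X.card : ℕ) : ℝ) = (X.filter p).card + (X.filter fun x => ¬ p x).card := by
      exact_mod_cast (Finset.card_filter_add_card_filter_not p).symm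
    rw [h3]
    push_cast
    linarith

/-- The cubic lower bound for the number of transferred words. -/
theorem cubic_le_cost (τ : Trace G M T) (D : Decomposition n G) (ho : D.root 1 n ∈ τ.slow T)
    (hM : 1 ≤ M) (hn : 6 * M + 1 ≤ n) :
    ((n : ℝ) - 6 * M - 1) ^ 3 / (18 * √(M : ℝ)) - 2 * M ≤ (τ.cost 0 T : ℝ) := by
  have hM' : (0 : ℝ) < M := by exact_mod_cast hM
  have hsq : 0 < √(M : ℝ) := Real.sqrt_pos.2 hM'
  have hc := cube_le_card_longTriples (n := n) (r := 3 * M) (by omega)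
  -- There are `q` full segments and a partial one; the latter costs the term `2 * M`.
  set q := τ.cost 0 T / (2 * M) with hq
  have hq1 : 2 * M * q ≤ τ.cost 0 T := Nat.mul_div_le _ _
  have hq2 : τ.cost 0 T ≤ 2 * M * (q + 1) := (Nat.lt_mul_div_succ _ (by omega)).le
  have hle := card_le_of_cost_le D ho q le_rfl hq2 (Finset.Subset.refl _) (fun x hx => by
    obtain ⟨h1, h2, h3, h4⟩ := mem_longTriples.1 hx
    obtain ⟨t, ht⟩ := exists_useful_leaf D ho h1 (m := x.2.1) (by omega) (by omega) h4
    exact ⟨t, ht.1, ht⟩)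
  have hq1' : 2 * (M : ℝ) * q ≤ τ.cost 0 T := by exact_mod_cast hq1
  rw [sub_le_iff_le_add, div_le_iff₀ (by positivity)]
  push_cast at hc
  calc ((n : ℝ) - 6 * M - 1) ^ 3 = ((n : ℝ) - 2 * (3 * M) - 1) ^ 3 := by ring
    _ ≤ 6 * ((longTriples n (3 * M)).card : ℝ) := hc
    _ ≤ 6 * (((q : ℝ) + 1) * (6 * M * √M)) := by gcongr
    _ = (2 * (M : ℝ) * q + 2 * M) * (18 * √M) := by ring
    _ ≤ _ := by gcongr

/-- Every input has to be loaded. -/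
theorem le_cost (τ : Trace G M T) (D : Decomposition n G) (ho : D.root 1 n ∈ τ.slow T)
    (hn : 2 ≤ n) : n ≤ τ.cost 0 T := by
  have hsub : (Finset.Icc 1 n).image (fun i => (i, i)) ⊆ τ.supply D 0 T := by
    intro p hp
    obtain ⟨i, hi, rfl⟩ := Finset.mem_image.1 hp
    obtain ⟨h1, h2⟩ := Finset.mem_Icc.1 hi
    have acc : τ.Accessed 0 T (D.root i i) := by
      -- The last input is a right operand in `S(1,n)`; any other input `i` is a left operand in
      -- `S(i,n)`.
      rcases h2.eq_or_lt with rfl | h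
      · obtain ⟨t, ht, hc, -⟩ := exists_useful_leaf D ho (i := 1) (m := i - 1) (j := i) le_rfl
          (by omega) (by omega) le_rfl
        have ha := D.adj_right (i := 1) (m := i - 1) (j := i) le_rfl (by omega) (by omega) le_rfl
        rw [Nat.sub_add_cancel h1] at ha
        exact ⟨t, by omega, ht.le, (τ.compute_legal t ht _ hc).2 _ ha⟩
      · obtain ⟨t, ht, hc, -⟩ := exists_useful_leaf D ho h1 le_rfl h le_rfl
        exact ⟨t, by omega, ht.le, (τ.compute_legal t ht _ hc).2 _ (D.adj_left h1 le_rfl h le_rfl)⟩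
    have := acc.sub_mem_supply_of_isInput (D := D) le_rfl (D.isInput_root h1 h2)
    rwa [D.sub_root h1 le_rfl h2] at this
  have h1 := Finset.card_le_card hsub
  rw [Finset.card_image_of_injective _ (fun a b h => congrArg Prod.fst h), Nat.card_Icc] at h1
  have h2 : (τ.supply D 0 T).card ≤ (τ.loaded 0 T).card := by
    rw [supply, τ.cache_zero, Finset.empty_union]
    exact Finset.card_image_le
  have h3 := τ.card_loaded_add_card_stored_le 0 T
  omega

end Trace

/-! ### The lower bound -/

/-- The lower bound for the number of transferred words. -/
theorem max_le_mul_ioCount {V : Type u} [DecidableEq V] {n M B : ℕ} (hn : 2 ≤ n) (hM : 1 ≤ M)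
    {G : Digraph V} (D : Decomposition n G) {mem₀ : ℕ → Option V} {ms : List (Move V)}
    (h : IsSchedule G M B mem₀ ms) :
    max (((n : ℝ) - 6 * M - 1) ^ 3 / (18 * √(M : ℝ)) - 2 * (M : ℝ)) (n : ℝ) ≤
      (B : ℝ) * (ioCount ms : ℝ) := by
  obtain ⟨ps, S', hp, hS', hcount⟩ := exists_pebblePath ms _ h.legal {v | IsInput G v}
    (fun a v hv => h.inputs_only a v hv)
  obtain ⟨τ, hslow, hcost⟩ := hp.exists_trace (fun v hv => hv)
  obtain ⟨a, ha⟩ := h.outputs_stored _ (D.isOutput_root (by omega))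
  have ho : D.root 1 n ∈ τ.slow ps.length := by
    rw [hslow]
    exact hS' a _ ha
  have hle : (τ.cost 0 ps.length : ℝ) ≤ B * ioCount ms := by
    rw [hcost]
    exact_mod_cast hcount
  have hlin : (n : ℝ) ≤ B * ioCount ms :=
    le_trans (by exact_mod_cast τ.le_cost D ho hn) hle
  refine max_le ?_ hlin
  -- Otherwise the cube is of a nonpositive number and the cubic bound is trivial.
  by_cases hnM : 6 * M + 1 ≤ n
  · exact (τ.cubic_le_cost D ho hM hnM).trans hle
  · have h1 : (n : ℝ) - 6 * M - 1 ≤ 0 := by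
      have : (n : ℝ) ≤ 6 * M + 1 := by exact_mod_cast (not_le.1 hnM).le
      linarith
    have h2 : ((n : ℝ) - 6 * M - 1) ^ 3 / (18 * √(M : ℝ)) ≤ 0 :=
      div_nonpos_of_nonpos_of_nonneg (Odd.pow_nonpos (by decide) h1) (by positivity)
    have h3 : (0 : ℝ) ≤ M := Nat.cast_nonneg M
    have h4 : (0 : ℝ) ≤ B * ioCount ms := by positivity
    linarith

theorem ofReal_le_ioComplexity {V : Type u} [DecidableEq V] {n M B : ℕ} (hn : 2 ≤ n)
    (hM : 1 ≤ M) (hB : 1 ≤ B) {G : Digraph V} (hG : G ∈ dpFamily V n) :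
    ENNReal.ofReal
        (max (((n : ℝ) - 6 * (M : ℝ) - 1) ^ 3 / (18 * √(M : ℝ)) - 2 * (M : ℝ)) (n : ℝ)
          * (1 / (B : ℝ))) ≤
      ((ioComplexity G M B : ℕ∞) : ENNReal) := by
  obtain ⟨D⟩ := hG
  have hB' : (0 : ℝ) < B := by exact_mod_cast hB
  -- Rounding up to a natural number lets the bound pass to the infimum in `ℕ∞`, including the value
  -- `⊤`.
  have h : ((⌈max (((n : ℝ) - 6 * (M : ℝ) - 1) ^ 3 / (18 * √(M : ℝ)) - 2 * (M : ℝ)) (n : ℝ)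
      * (1 / (B : ℝ))⌉₊ : ℕ) : ℕ∞) ≤ ioComplexity G M B := by
    refine le_iInf fun mem₀ => le_iInf fun ms => le_iInf fun hs => ?_
    rw [Nat.cast_le, Nat.ceil_le, mul_one_div, div_le_iff₀ hB', mul_comm (ioCount ms : ℝ)]
    exact max_le_mul_ioCount hn hM D hs
  refine le_trans ?_ (ENat.toENNReal_le.2 h)
  rw [ENat.toENNReal_coe, ← ENNReal.ofReal_natCast]
  exact ENNReal.ofReal_le_ofReal (Nat.le_ceil _)

/-- When the cache is small, the lower bound is of cubic order. -/
theorem cubic_order_le {n M : ℝ} (hM : 1 ≤ M) (hMn : M ≤ 1 / 24 * n) :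
    1 / 200 * (n ^ 3 / √M) ≤ (n - 6 * M - 1) ^ 3 / (18 * √M) - 2 * M := by
  have hs : 0 < √M := Real.sqrt_pos.2 (by linarith)
  have hs1 : √M ≤ M := by
    rw [Real.sqrt_le_left (by linarith)]
    nlinarith
  have h1 : n / 2 ≤ n - 6 * M - 1 := by linarith
  have h2 : (n / 2) ^ 3 ≤ (n - 6 * M - 1) ^ 3 := by
    gcongr
    linarith
  -- Here `6912 = 24 ^ 3 / 2`. The final comparison is `18 / 200 + 18 / 6912 ≤ 1 / 8`.
  have h3 : 2 * M * √M ≤ n ^ 3 / 6912 := by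
    have a : M * √M ≤ M ^ 3 := by
      calc M * √M ≤ M * M := by gcongr
        _ ≤ M ^ 3 := by nlinarith [mul_nonneg (by linarith : 0 ≤ M) (by linarith : 0 ≤ M)]
    have b : M ^ 3 ≤ (1 / 24 * n) ^ 3 := by gcongr
    nlinarith
  have hn : 0 ≤ n ^ 3 := by
    have : 0 ≤ n := by linarith
    positivity
  rw [le_sub_iff_add_le, le_div_iff₀ (by positivity)]
  have e : (1 / 200 * (n ^ 3 / √M) + 2 * M) * (18 * √M) = 18 / 200 * n ^ 3 + 18 * (2 * M * √M) := by
    field_simp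
  rw [e]
  nlinarith

end DPIO

theorem theorem2 :
    (∀ (V : Type u) [Finite V] [DecidableEq V] (n M B : ℕ), 2 ≤ n → 1 ≤ M → 1 ≤ B →
      ∀ G ∈ DPIO.dpFamily V n,
        ENNReal.ofReal
            (max (((n : ℝ) - 6 * (M : ℝ) - 1) ^ 3 / (18 * √(M : ℝ)) - 2 * (M : ℝ)) (n : ℝ)
              * (1 / (B : ℝ))) ≤
          ((DPIO.ioComplexity G M B : ℕ∞) : ENNReal)) ∧
    (∃ c > (0 : ℝ), ∃ K > (0 : ℝ),
      ∀ (V : Type u) [Finite V] [DecidableEq V] (n M B : ℕ), 2 ≤ n → 1 ≤ M → 1 ≤ B →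
        (M : ℝ) ≤ c * (n : ℝ) →
        ∀ G ∈ DPIO.dpFamily V n,
          ENNReal.ofReal (K * ((n : ℝ) ^ 3 / (√(M : ℝ) * (B : ℝ)))) ≤
            ((DPIO.ioComplexity G M B : ℕ∞) : ENNReal)) := by
  refine ⟨fun V _ _ n M B hn hM hB G hG => DPIO.ofReal_le_ioComplexity hn hM hB hG,
    1 / 24, by norm_num, 1 / 200, by norm_num, fun V _ _ n M B hn hM hB hMn G hG => ?_⟩
  refine (ENNReal.ofReal_le_ofReal ?_).trans (DPIO.ofReal_le_ioComplexity hn hM hB hG)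
  rw [← div_div, ← mul_div_assoc, mul_one_div]
  gcongr
  exact (DPIO.cubic_order_le (by exact_mod_cast hM) hMn).trans (le_max_left _ _)
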